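/- Let $m,n\ge 1$ and $L>2$. Identify the plane with $\mathbb{C}$. The crease pattern $S(m,n)$ of the $m\times n$ square twist tessellation is drawn on an $nL\times mL$ rectangular sheet of paper (width $nL$, height $mL$) divided into $mn$ cells of side $L$. The cell in row $i$ and column $j$ ($0\le i<m$, $0\le j<n$) has centre $c_{ij}=L(j+i\sqrt{-1})$ and contains a square with corners $c_{ij}+(\sqrt{-1})^d$, $d\in\mathbb{Z}/4$, whose four sides are creases. In each of the four directions $(\sqrt{-1})^d$ a pleat leaves the square; it consists of two parallel creases in that direction, one starting at corner $d$ and the other at corner $d-(-1)^{i+j}$ (so neighbouring twists are mirror images of each other). The pleat creases join the corresponding corners of neighbouring squares, or end at the border of the paper. Every interior vertex thus has four creases, with cyclic angle sequence $45^\circ, 90^\circ, 135^\circ, 90^\circ$ up to orientation. A mountain-valley assignment is a map from the set of creases to $\{1,-1\}$ ($1$ for mountain, $-1$ for valley). It locally folds flat if at every vertex $v$ in the interior of the paper a neighbourhood of $v$ can be folded flat without self-intersection, with all the creases at $v$ folded as prescribed; that is, the piecewise isometric map which reverses the orientation of the paper across each crease is well defined around $v$, and the sectors at $v$ can be layered consistently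 with the mountains and valleys so that no layer passes through a crease joining two other layers and no two creases folded onto each other on the same side interlace. Theorem. The number of mountain-valley assignments of $S(m,n)$ that locally fold flat is $2^{2mn+m+n}$. -/

import Mathlib

open scoped Real

noncomputable section

/-! ## Crease patterns and mountain-valley assignments -/

/-- A straight-line drawing of a graph on a sheet of paper in the plane `ℂ`; the edges of the graph
are the creases. -/
structure CreasePattern where
  /-- the sheet of paper -/
  paper : Set ℂ
  /-- the vertices, both those in the interior of the paper and those on its boundary -/
  Vertex : Type
  /-- the position of a vertex on the paper -/
  pos : Vertex → ℂ
  /-- the graph whose edges are the creases -/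
  graph : SimpleGraph Vertex

namespace CreasePattern

/-- A mountain-valley assignment: `1` on the mountain creases, `-1` on the valley creases. -/
abbrev MVAssignment (C : CreasePattern) : Type := C.graph.edgeSet → ℤˣ

/-- A vertex in the interior of the paper. -/
def IsInterior (C : CreasePattern) (v : C.Vertex) : Prop := C.pos v ∈ interior C.paper

end CreasePattern

/-! ## Flat foldings of a single vertex

The creases at the vertex are numbered `0, …, k - 1` counterclockwise (cyclically, in `Fin k`).
Sector `i` is the sector from crease `i` to crease `i + 1`, and `α i` is its angle. A small circle
around the vertex is folded onto a circle; as the total angle is `2π` and the folded curve is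
closed, its image is an arc of length at most `π`, on which an angular coordinate in `ℝ` is used. -/

/-- The angular coordinate, after folding, of the point reached after traversing the first `i`
sectors, when sector `0` is laid down face up starting at coordinate `0`: the direction of
travel is reversed at every crease. -/
def foldPos {k : ℕ} (α : Fin k → ℝ) (i : ℕ) : ℝ :=
  ∑ j : Fin k with j.val < i, (-1) ^ j.val * α j

/-- The (open) image of sector `i` under the folding. -/
def sectorImage {k : ℕ} (α : Fin k → ℝ) (i : Fin k) : Set ℝ :=
  Set.Ioo (min (foldPos α i.val) (foldPos α (i.val + 1)))
    (max (foldPos α i.val) (foldPos α (i.val + 1)))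

/-- Layer `j` lies strictly between the layers `i` and `l`. -/
def LayerBetween {ι : Type*} (above : ι → ι → Prop) (i j l : ι) : Prop :=
  (above i j ∧ above j l) ∨ (above l j ∧ above j i)

/-- The relation `above` is a layer order that turns the folding map of a vertex with angle
sequence `α` into a flat folding without self-intersection in which all creases are folded, the
mountains and valleys being those prescribed by `μ`. The sectors of even index are face up and
those of odd index are face down. -/
structure IsFlatFolding {k : ℕ} [NeZero k] (α : Fin k → ℝ) (μ : Fin k → ℤˣ)
    (above : Fin k → Fin k → Prop) : Prop where
  /-- After one turn around the vertex the orientation of the paper is restored. -/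
  even : Even k
  /-- After one turn around the vertex the folding map returns to its starting point. -/
  closed : foldPos α k = 0
  /-- Of two sectors that overlap after folding, exactly one lies above the other. -/
  total : ∀ i j, i ≠ j → (sectorImage α i ∩ sectorImage α j).Nonempty →
    (above i j ↔ ¬ above j i)
  /-- The layers over a common point are stacked transitively. -/
  trans : ∀ i j l, (sectorImage α i ∩ sectorImage α j ∩ sectorImage α l).Nonempty →
    above i j → above j l → above i l
  /-- Along a valley crease the upper sides of the paper face each other: the face-down sector
  lies above the face-up one. Along a mountain crease it lies below. -/
  valley_iff : ∀ i : Fin k,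
    μ (i + 1) = -1 ↔ if Even i.val then above (i + 1) i else above i (i + 1)
  /-- A layer that passes through the image of a crease does not lie between the two layers that
  are joined at this crease. -/
  crease_layer : ∀ i j : Fin k, j ≠ i → j ≠ i + 1 →
    foldPos α (i.val + 1) ∈ sectorImage α j → ¬ LayerBetween above i j (i + 1)
  /-- Two creases that are folded onto each other with their sectors on the same side are not
  interlaced. -/
  crease_crease : ∀ i j : Fin k, i ≠ j → (Even i.val ↔ Even j.val) →
    foldPos α (i.val + 1) = foldPos α (j.val + 1) →
    (LayerBetween above i j (i + 1) ↔ LayerBetween above i (j + 1) (i + 1))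

/-- The counterclockwise angle in `(0, 2π]` from the direction of `z` to the direction of `w`. -/
def ccwAngle (z w : ℂ) : ℝ := toIocMod Real.two_pi_pos 0 (w / z).arg

namespace CreasePattern

/-- The vertex `v` (with at least one crease) folds flat under `μ`: if `e` lists the creases at `v`
in counterclockwise order, so that the angles between consecutive creases add up to one full turn,
then the angle sequence has a flat folding with the mountains and valleys of `μ`. -/
def FoldsFlatAt (C : CreasePattern) (μ : C.MVAssignment) (v : C.Vertex) : Prop :=
  ∃ (k : ℕ) (_ : NeZero k) (e : Fin k ≃ C.graph.neighborSet v) (α : Fin k → ℝ),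
    (∀ i, α i = ccwAngle (C.pos (e i) - C.pos v) (C.pos (e (i + 1)) - C.pos v)) ∧
    ∑ i, α i = 2 * π ∧
    ∃ above : Fin k → Fin k → Prop,
      IsFlatFolding α
        (fun i => μ ⟨s(v, (e i : C.Vertex)), C.graph.mem_edgeSet.2 (e i).2⟩) above

/-- Every interior vertex folds flat under `μ`. -/
def LocallyFoldsFlat (C : CreasePattern) (μ : C.MVAssignment) : Prop :=
  ∀ v, C.IsInterior v → C.FoldsFlatAt μ v

end CreasePattern

/-! ## Square twist tessellations

The twist in row `i` and column `j` has its centre at `L * (j + i * I)`. The corners of its square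
are the points at distance `1` from the centre in the directions `I ^ d`, where
`d = 0, 1, 2, 3` stands for east, north, west, south. One pleat leaves in each of these directions.
Neighbouring twists are mirror images of each other. -/

namespace SquareTwist

/-- The chirality `±1` of the twist in row `i` and column `j`. -/
def chirality (R : Type*) [Ring R] (i j : ℕ) : R := (-1) ^ (i + j)

/-- The twist in row `i` and column `j` of an `m × n` grid has no neighbour in direction `d`. -/
def OnBorder {m n : ℕ} (i : Fin m) (j : Fin n) (d : ZMod 4) : Prop :=
  (d = 0 ∧ j.val + 1 = n) ∨ (d = 1 ∧ i.val + 1 = m) ∨ (d = 2 ∧ j.val = 0) ∨ (d = 3 ∧ i.val = 0)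

/-- The vertices: the corners of the squares, and the points where the creases of the pleats
reach the border of the paper. The pleat of the twist `(i, j)` in direction `d` is bounded by the
crease through the corner `d` (`b = false`) and the crease through the corner
`d - chirality i j` (`b = true`). -/
inductive Vertex (m n : ℕ) : Type
  | corner (i : Fin m) (j : Fin n) (d : ZMod 4)
  | border (i : Fin m) (j : Fin n) (d : ZMod 4) (h : OnBorder i j d) (b : Bool)

/-- The centre of a twist. -/
def center (L : ℝ) (i j : ℕ) : ℂ := (L : ℂ) * ((j : ℂ) + (i : ℂ) * Complex.I)

/-- The positions of the vertices. -/
def position {m n : ℕ} (L : ℝ) : Vertex m n → ℂ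
  | .corner i j d => center L i j + Complex.I ^ d.val
  | .border i j d _ false => center L i j + ((L / 2 : ℝ) : ℂ) * Complex.I ^ d.val
  | .border i j d _ true => center L i j + ((L / 2 : ℝ) : ℂ) * Complex.I ^ d.val
      + Complex.I ^ (d - chirality (ZMod 4) i j).val

/-- The creases, each with one of its two orientations. -/
inductive Crease (m n : ℕ) : Vertex m n → Vertex m n → Prop
  /-- the sides of the squares -/
  | side (i : Fin m) (j : Fin n) (d : ZMod 4) :
      Crease m n (.corner i j d) (.corner i j (d + 1))
  /-- the two creases of the pleat between a twist and its right neighbour -/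
  | east (i : Fin m) (j j' : Fin n) (h : j.val + 1 = j'.val) :
      Crease m n (.corner i j 0) (.corner i j' 2)
  | east' (i : Fin m) (j j' : Fin n) (h : j.val + 1 = j'.val) :
      Crease m n (.corner i j (0 - chirality (ZMod 4) i j))
        (.corner i j' (0 - chirality (ZMod 4) i j))
  /-- the two creases of the pleat between a twist and its upper neighbour -/
  | north (i i' : Fin m) (j : Fin n) (h : i.val + 1 = i'.val) :
      Crease m n (.corner i j 1) (.corner i' j 3)
  | north' (i i' : Fin m) (j : Fin n) (h : i.val + 1 = i'.val) :
      Crease m n (.corner i j (1 - chirality (ZMod 4) i j))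
        (.corner i' j (1 - chirality (ZMod 4) i j))
  /-- the two creases of a pleat that runs into the border -/
  | border (i : Fin m) (j : Fin n) (d : ZMod 4) (h : OnBorder i j d) :
      Crease m n (.corner i j d) (.border i j d h false)
  | border' (i : Fin m) (j : Fin n) (d : ZMod 4) (h : OnBorder i j d) :
      Crease m n (.corner i j (d - chirality (ZMod 4) i j)) (.border i j d h true)

end SquareTwist

/-- The `m × n` square twist tessellation with squares of diagonal `2` and centres at distance `L`,
on a rectangular sheet of paper of width `n * L` and height `m * L`. -/
def squareTwistTessellation (m n : ℕ) (L : ℝ) : CreasePattern where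
  paper := Set.Icc (-(L / 2)) ((n : ℝ) * L - L / 2) ×ℂ
    Set.Icc (-(L / 2)) ((m : ℝ) * L - L / 2)
  Vertex := SquareTwist.Vertex m n
  pos := SquareTwist.position L
  graph := SimpleGraph.fromRel (SquareTwist.Crease m n)

end

/-! At a vertex with angles 45°, 90°, 135°, 90°, all four folded sectors overlap, so the layers are
linearly ordered. No other layer may separate the two layers joined at a crease bounding the 45°
sector. Hence the two 90° sectors lie on opposite sides of the 45° sector, whose bounding creases
therefore differ, and the 135° sector lies above or below all three others, so its bounding creases
agree. Conversely, every assignment with these two properties has a layer order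
(`IsFlatFolding.mv_of_twistAngle`, `isFlatFolding_twistAngle`).

For a corner `d` of a twist with chirality `c`, the 45° sector lies between a pleat crease and a
square side belonging to the pleat in direction `d + c`, and the 135° sector between a crease and a
side belonging to the pleat in direction `d`. The conditions thus decouple: at each end of a pleat,
one crease equals the square side between the two creases and the other is its negative
(`locallyFoldsFlat_iff`). As neighbouring twists are mirror images, both ends give compatible
conditions (`pleatEdge_step`). One free sign per pleat remains, and there are `m * (n + 1) + (m + 1)
* n` pleats. -/

/-! ## Flat foldings of a vertex with angles 45°, 90°, 135°, 90° -/

/-- The angles of the sectors of a vertex of the tessellation, in units of `π / 8`, counterclockwise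
from the smallest one, when that sector has number `s`. -/
def twistAngle (s i : Fin 4) : ℤ := ![2, 4, 6, 4] (i - s)

/-- The angular coordinate after folding in units of `π / 8`. -/
def twistFoldPos (s : Fin 4) (i : ℕ) : ℤ :=
  ∑ j : Fin 4 with j.val < i, (-1) ^ j.val * twistAngle s j

theorem foldPos_twistAngle (s : Fin 4) (i : ℕ) :
    foldPos (fun j => π / 8 * (twistAngle s j : ℝ)) i = π / 8 * (twistFoldPos s i : ℝ) := by
  simp only [foldPos, twistFoldPos, Int.cast_sum, Finset.mul_sum]
  refine Finset.sum_congr rfl fun j _ => ?_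
  push_cast
  ring

/-- The coordinate `x` lies in the open image of sector `i`. -/
abbrev InTwistSector (s i : Fin 4) (x : ℤ) : Prop :=
  min (twistFoldPos s i.val) (twistFoldPos s (i.val + 1)) < x ∧
    x < max (twistFoldPos s i.val) (twistFoldPos s (i.val + 1))

theorem mem_sectorImage_twistAngle (s i : Fin 4) (x : ℤ) :
    π / 8 * (x : ℝ) ∈ sectorImage (fun j => π / 8 * (twistAngle s j : ℝ)) i ↔
      InTwistSector s i x := by
  have h : 0 < π / 8 := by positivity
  simp only [sectorImage, foldPos_twistAngle, ← mul_min_of_nonneg _ _ h.le,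
    ← mul_max_of_nonneg _ _ h.le, Set.mem_Ioo, mul_lt_mul_iff_right₀ h]
  norm_cast

/-- The image of the 45° sector is contained in all the others. In units of `π / 8` its midpoint is
an integer, which is why this unit is used. A common point makes totality and transitivity of the
layer order available for all sectors. -/
theorem exists_common_twistSector : ∀ s : Fin 4, ∃ x ∈ Finset.Icc (-8 : ℤ) 8,
    ∀ i, InTwistSector s i x := by
  decide +kernel

/-- Each crease bounding the 45° sector `s` is folded into the interior of the two sectors not
adjacent to it; these are the places where `crease_layer` applies. -/
theorem inTwistSector_crease : ∀ s : Fin 4,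
    InTwistSector s (s + 2) (twistFoldPos s (s.val + 1)) ∧
    InTwistSector s (s + 3) (twistFoldPos s (s.val + 1)) ∧
    InTwistSector s (s + 1) (twistFoldPos s ((s + 3).val + 1)) ∧
    InTwistSector s (s + 2) (twistFoldPos s ((s + 3).val + 1)) := by
  decide +kernel

theorem IsFlatFolding.mv_of_twistAngle {s : Fin 4} {μ : Fin 4 → ℤˣ} {above : Fin 4 → Fin 4 → Prop}
    (h : IsFlatFolding (fun j => π / 8 * (twistAngle s j : ℝ)) μ above) :
    μ (s + 1) = -μ s ∧ μ (s + 3) = μ (s + 2) := by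
  obtain ⟨x, -, hx⟩ := exists_common_twistSector s
  have hx' := fun i => (mem_sectorImage_twistAngle s i x).2 (hx i)
  have tot : ∀ i j, i ≠ j → (above i j ↔ ¬ above j i) := fun i j hij =>
    h.total i j hij ⟨_, hx' i, hx' j⟩
  have tr : ∀ i j l, above i j → above j l → above i l := fun i j l =>
    h.trans i j l ⟨_, ⟨hx' i, hx' j⟩, hx' l⟩
  have cl : ∀ i j, j ≠ i → j ≠ i + 1 → InTwistSector s j (twistFoldPos s (i.val + 1)) →
      ¬ LayerBetween above i j (i + 1) := fun i j h1 h2 h3 =>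
    h.crease_layer i j h1 h2 (by
      rw [foldPos_twistAngle]
      exact (mem_sectorImage_twistAngle ..).2 h3)
  obtain ⟨c1, c2, c3, c4⟩ := inTwistSector_crease s
  have d1 := cl s (s + 2) (by clear * -; revert s; decide) (by clear * -; revert s; decide) c1
  have d2 := cl s (s + 3) (by clear * -; revert s; decide) (by clear * -; revert s; decide) c2
  have d3 := cl (s + 3) (s + 1) (by clear * -; revert s; decide) (by clear * -; revert s; decide) c3
  have d4 := cl (s + 3) (s + 2) (by clear * -; revert s; decide) (by clear * -; revert s; decide) c4
  have v0 := h.valley_iff s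
  have v1 := h.valley_iff (s + 1)
  have v2 := h.valley_iff (s + 2)
  have v3 := h.valley_iff (s + 3)
  have e1 : Even (s + 1).val ↔ ¬ Even s.val := by clear * -; revert s; decide
  have e2 : Even (s + 2).val ↔ Even s.val := by clear * -; revert s; decide
  have e3 : Even (s + 3).val ↔ ¬ Even s.val := by clear * -; revert s; decide
  have a1 : s + 1 + 1 = s + 2 := by clear * -; revert s; decide
  have a2 : s + 2 + 1 = s + 3 := by clear * -; revert s; decide
  have a3 : s + 3 + 1 = s := by clear * -; revert s; decide
  have t01 := tot s (s + 1) (by clear * -; revert s; decide)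
  have t02 := tot s (s + 2) (by clear * -; revert s; decide)
  have t03 := tot s (s + 3) (by clear * -; revert s; decide)
  have t12 := tot (s + 1) (s + 2) (by clear * -; revert s; decide)
  have t13 := tot (s + 1) (s + 3) (by clear * -; revert s; decide)
  have t23 := tot (s + 2) (s + 3) (by clear * -; revert s; decide)
  simp only [a1, a2, a3, e1, e2, e3, LayerBetween] at *
  generalize s + 1 = s1 at *
  generalize s + 2 = s2 at *
  generalize s + 3 = s3 at *
  have n : ∀ u v : ℤˣ, u = -v ↔ (u = -1 ↔ ¬ v = -1) := by decide
  have n' : ∀ u v : ℤˣ, u = v ↔ (u = -1 ↔ v = -1) := by decide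
  rw [n' (μ s3), n (μ s1), v0, v1, v2, v3]
  by_cases hs : Even s.val
  all_goals
    simp only [hs, if_true, if_false, not_true_eq_false, not_false_eq_true] at *
    -- These two instances of transitivity suffice; what remains is propositional.
    have := tr s1 s s2
    have := tr s2 s s1
    clear tot tr cl hx hx' h v0 v1 v2 v3 n n'
    grind

/-- A layer order of the sectors, as the list of their heights, when the crease between the first
two sectors has `f` and the other square side and pleat crease have `g`. -/
def twistHeight (f g : Bool) : Fin 4 → ℕ :=
  ![2, if f then 3 else 1, if g then 0 else 4, if f then 1 else 3]

theorem isFlatFolding_twistAngle (μ : Fin 4 → ℤˣ) (h₁ : μ 1 = -μ 0) (h₂ : μ 3 = μ 2) :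
    ∃ above, IsFlatFolding (fun j => π / 8 * (twistAngle 0 j : ℝ)) μ above := by
  have hμ : μ = ![μ 0, -μ 0, μ 2, μ 2] := by
    funext i; fin_cases i <;> simp [h₁, h₂]
  generalize μ 0 = a at hμ
  generalize μ 2 = b at hμ
  subst hμ
  set ht := twistHeight (decide (a = 1)) (decide (b = -1)) with hht
  refine ⟨fun i j => ht j < ht i, ⟨by decide, ?_, ?_, ?_, ?_, ?_, ?_⟩⟩
  · rw [foldPos_twistAngle, show twistFoldPos 0 4 = 0 by decide +kernel]; simp
  · intro i j hij _
    have : ht i ≠ ht j := by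
      rw [hht]; clear * - hij; revert a b i j; decide +kernel
    omega
  · intro i j l _ _ _; omega
  · rw [hht]; clear * -; revert a b; decide +kernel
  · intro i j h1 h2 h3
    rw [foldPos_twistAngle, mem_sectorImage_twistAngle] at h3
    rw [hht, LayerBetween]; clear * - h1 h2 h3; revert a b i j; decide +kernel
  -- The four creases land on distinct points, so this condition is vacuous.
  · intro i j h1 h2 h3
    rw [foldPos_twistAngle, foldPos_twistAngle, mul_right_inj' (by positivity)] at h3
    norm_cast at h3
    exfalso
    clear * - h1 h2 h3; revert i j; decide +kernel

/-! ## The vertices of the tessellation -/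

/-- Shifting by one around the reduction mod 8 gives representatives from 1 to 8, matching the
interval `(0, 2π]`: equal directions are a full turn apart. -/
theorem ccwAngle_exp {u : ℂ} (hu : u ≠ 0) {r r' : ℝ} (hr : 0 < r) (hr' : 0 < r') (a b : ℤ) :
    ccwAngle (r * (u * Complex.exp ((π / 4 * a : ℝ) * Complex.I)))
      (r' * (u * Complex.exp ((π / 4 * b : ℝ) * Complex.I))) =
      π / 8 * ((2 * (1 + (b - a - 1) % 8) : ℤ) : ℝ) := by
  have hr0 : (r : ℂ) ≠ 0 := by exact_mod_cast hr.ne'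
  have key : (r' * (u * Complex.exp ((π / 4 * b : ℝ) * Complex.I))) /
      (r * (u * Complex.exp ((π / 4 * a : ℝ) * Complex.I))) =
      ((r' / r : ℝ) : ℂ) * Complex.exp ((π / 4 * (b - a) : ℝ) * Complex.I) := by
    have : Complex.exp ((π / 4 * b : ℝ) * Complex.I) =
        Complex.exp ((π / 4 * (b - a) : ℝ) * Complex.I) *
          Complex.exp ((π / 4 * a : ℝ) * Complex.I) := by
      rw [← Complex.exp_add]; congr 1; push_cast; ring
    rw [this]
    have := Complex.exp_ne_zero ((π / 4 * a : ℝ) * Complex.I)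
    push_cast
    field_simp
  rw [ccwAngle, key, Complex.arg_real_mul _ (div_pos hr' hr), Complex.arg_exp_mul_I]
  have h8 : (b - a - 1) % 8 = b - a - 1 - 8 * ((b - a - 1) / 8) := by omega
  have lo : 0 ≤ (b - a - 1) % 8 := by omega
  have hi : (b - a - 1) % 8 ≤ 7 := by omega
  have hlo : (0 : ℝ) ≤ ((b - a - 1) % 8 : ℤ) := by exact_mod_cast lo
  have hhi : (((b - a - 1) % 8 : ℤ) : ℝ) ≤ 7 := by exact_mod_cast hi
  have hc : (((b - a - 1) % 8 : ℤ) : ℝ) = b - a - 1 - 8 * ((b - a - 1) / 8 : ℤ) := by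
    exact_mod_cast h8
  rw [toIocMod_eq_iff]
  refine ⟨⟨by push_cast at hlo ⊢; positivity, ?_⟩, ?_⟩
  · push_cast at hhi ⊢
    nlinarith [Real.pi_pos]
  -- The full turns removed by the reduction mod 8, less those already removed by `Complex.arg`.
  · refine ⟨(b - a - 1) / 8 - toIocDiv (mul_pos two_pos Real.pi_pos) (-π) (π / 4 * (b - a)), ?_⟩
    rw [toIocMod]
    push_cast at hc ⊢
    rw [hc]
    simp only [zsmul_eq_mul]
    push_cast
    ring

/-- The directions of the four creases at a vertex in units of `π / 4`. -/
def twistDir : Fin 4 → ℤ := ![0, 1, 3, 6]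

/-- Listing the four directions in any other cyclic order goes around the vertex more than once.
This leaves only the choice of the starting crease in `FoldsFlatAt`. -/
theorem exists_shift_of_sum_angle : ∀ σ : Fin 4 → Fin 4, Function.Injective σ →
    ∑ i, 2 * (1 + (twistDir (σ (i + 1)) - twistDir (σ i) - 1) % 8) = 16 →
    ∃ s, ∀ i, σ i = i - s := by
  decide +kernel

theorem twistAngle_eq : ∀ s i : Fin 4,
    2 * (1 + (twistDir (i + 1 - s) - twistDir (i - s) - 1) % 8) = twistAngle s i := by
  decide +kernel

namespace CreasePattern

/-- Here `u` is the direction of crease 0; creases 0 and 1 bound the 45° sector, creases 2 and 3 the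
135° sector. -/
theorem foldsFlatAt_iff (C : CreasePattern) (μ : C.MVAssignment) (v : C.Vertex)
    (nb : Fin 4 ≃ C.graph.neighborSet v) {u : ℂ} (hu : u ≠ 0) (r : Fin 4 → ℝ) (hr : ∀ i, 0 < r i)
    (hpos : ∀ i, C.pos (nb i) - C.pos v =
      r i * (u * Complex.exp ((π / 4 * twistDir i : ℝ) * Complex.I))) :
    C.FoldsFlatAt μ v ↔
      μ ⟨s(v, nb 1), C.graph.mem_edgeSet.2 (nb 1).2⟩ =
        -μ ⟨s(v, nb 0), C.graph.mem_edgeSet.2 (nb 0).2⟩ ∧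
      μ ⟨s(v, nb 3), C.graph.mem_edgeSet.2 (nb 3).2⟩ =
        μ ⟨s(v, nb 2), C.graph.mem_edgeSet.2 (nb 2).2⟩ := by
  constructor
  · rintro ⟨k, _, e, α, hα, hsum, above, h⟩
    obtain rfl : k = 4 := Fin.equiv_iff_eq.1 ⟨e.trans nb.symm⟩
    obtain ⟨σ, hσ⟩ : ∃ σ : Fin 4 → Fin 4, σ = e.trans nb.symm := ⟨_, rfl⟩
    have he : ∀ i, e i = nb (σ i) := fun i => by simp [hσ]
    have hinj : Function.Injective σ := hσ ▸ (e.trans nb.symm).injective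
    have hα' : ∀ i, α i =
        π / 8 * ((2 * (1 + (twistDir (σ (i + 1)) - twistDir (σ i) - 1) % 8) : ℤ) : ℝ) := by
      intro i
      rw [hα i, he, he, hpos, hpos, ccwAngle_exp hu (hr _) (hr _)]
    have hs : ∑ i, 2 * (1 + (twistDir (σ (i + 1)) - twistDir (σ i) - 1) % 8) = 16 := by
      simp only [hα', ← Finset.mul_sum, ← Int.cast_sum] at hsum
      have : ((∑ i, 2 * (1 + (twistDir (σ (i + 1)) - twistDir (σ i) - 1) % 8) : ℤ) : ℝ) = 16 := by
        have := Real.pi_pos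
        rw [← Finset.mul_sum]
        push_cast at hsum ⊢
        nlinarith
      exact_mod_cast this
    obtain ⟨s, hs⟩ := exists_shift_of_sum_angle σ hinj hs
    have hα'' : α = fun i => π / 8 * (twistAngle s i : ℝ) := by
      funext i
      rw [hα', hs, hs, twistAngle_eq]
    subst hα''
    have := h.mv_of_twistAngle
    have he0 : e s = nb 0 := by rw [he, hs, sub_self]
    have he1 : e (s + 1) = nb 1 := by rw [he, hs, add_sub_cancel_left]
    have he2 : e (s + 2) = nb 2 := by rw [he, hs, add_sub_cancel_left]
    have he3 : e (s + 3) = nb 3 := by rw [he, hs, add_sub_cancel_left]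
    simpa only [he0, he1, he2, he3] using this
  · rintro ⟨h1, h2⟩
    refine ⟨4, inferInstance, nb, fun i => π / 8 * (twistAngle 0 i : ℝ), fun i => ?_, ?_,
      isFlatFolding_twistAngle _ h1 h2⟩
    · beta_reduce
      rw [hpos, hpos, ccwAngle_exp hu (hr _) (hr _), ← twistAngle_eq, sub_zero, sub_zero]
    · rw [← Finset.mul_sum, ← Int.cast_sum, show ∑ i, twistAngle 0 i = 16 by decide +kernel]
      push_cast
      ring

end CreasePattern

theorem CreasePattern.foldsFlatAt_iff_of_range (C : CreasePattern) (μ : C.MVAssignment)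
    (v : C.Vertex) (nb : Fin 4 → C.Vertex) (hnb : ∀ w, C.graph.Adj v w ↔ ∃ k, nb k = w) {u : ℂ}
    (hu : u ≠ 0) (r : Fin 4 → ℝ) (hr : ∀ i, 0 < r i)
    (hpos : ∀ i, C.pos (nb i) - C.pos v =
      r i * (u * Complex.exp ((π / 4 * twistDir i : ℝ) * Complex.I))) :
    C.FoldsFlatAt μ v ↔
      μ ⟨s(v, nb 1), (hnb _).2 ⟨1, rfl⟩⟩ = -μ ⟨s(v, nb 0), (hnb _).2 ⟨0, rfl⟩⟩ ∧
      μ ⟨s(v, nb 3), (hnb _).2 ⟨3, rfl⟩⟩ = μ ⟨s(v, nb 2), (hnb _).2 ⟨2, rfl⟩⟩ := by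
  have hinj : Function.Injective nb := by
    intro a b hab
    -- If two neighbours coincide, the angle between them is a full turn, so their directions agree
    -- mod 8.
    have h := ccwAngle_exp hu (hr a) (hr b) (twistDir a) (twistDir b)
    rw [← hpos, ← hpos, ← hab, hpos, ccwAngle_exp hu (hr a) (hr a),
      mul_right_inj' (by positivity)] at h
    norm_cast at h
    clear * - h
    revert a b
    decide +kernel
  let f : Fin 4 → C.graph.neighborSet v := fun k => ⟨nb k, (hnb _).2 ⟨k, rfl⟩⟩
  have hf : Function.Bijective f :=
    ⟨fun a b h => hinj (congrArg Subtype.val h),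
      fun w => by
        obtain ⟨k, hk⟩ := (hnb _).1 w.2
        exact ⟨k, Subtype.ext hk⟩⟩
  exact C.foldsFlatAt_iff μ v (Equiv.ofBijective f hf) hu r hr hpos

theorem exp_twistDir (k : Fin 4) : Complex.exp ((π / 4 * twistDir k : ℝ) * Complex.I) =
    ![1, (1 + Complex.I) / (√2 : ℝ), (-1 + Complex.I) / (√2 : ℝ), -Complex.I] k := by
  have h2 : ((√2 : ℝ) : ℂ) * (√2 : ℝ) = 2 := by
    rw [← Complex.ofReal_mul, Real.mul_self_sqrt (by norm_num)]; simp
  have h0 : ((√2 : ℝ) : ℂ) ≠ 0 := by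
    intro h; simp [h] at h2
  rw [Complex.exp_mul_I, ← Complex.ofReal_cos, ← Complex.ofReal_sin]
  fin_cases k
  · simp [twistDir]
  · simp [twistDir]
    field_simp
    linear_combination (1 + Complex.I) * h2
  · have : π / 4 * 3 = π - π / 4 := by ring
    simp [twistDir, this]
    field_simp
    linear_combination (-1 + Complex.I) * h2
  · have : π / 4 * 6 = π / 2 + π := by ring
    simp [twistDir, this, Real.cos_add_pi, Real.sin_add_pi]

/-! ### Incidence of the square sides and pleat creases -/

namespace SquareTwist

variable {m n : ℕ}

theorem direction_cases : ∀ d : ZMod 4, d = 0 ∨ d = 1 ∨ d = 2 ∨ d = 3 := by decide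

theorem chirality_cases (i j : ℕ) : chirality (ZMod 4) i j = 1 ∨ chirality (ZMod 4) i j = -1 :=
  neg_one_pow_eq_or _ _

/-- The row of the neighbour in direction `d`. -/
def stepRow (i : Fin m) (d : ZMod 4) : Fin m :=
  -- At the border the value is clamped; this default is never relevant, as steps are only taken
  -- under `¬ OnBorder`.
  if d = 1 then ⟨min (i.val + 1) (m - 1), by omega⟩
  else if d = 3 then ⟨i.val - 1, by omega⟩ else i

/-- The column of the neighbour in direction `d`. -/
def stepCol (j : Fin n) (d : ZMod 4) : Fin n :=
  if d = 0 then ⟨min (j.val + 1) (n - 1), by omega⟩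
  else if d = 2 then ⟨j.val - 1, by omega⟩ else j

open Classical in
/-- The other end of the crease of the pleat `(i, j, d)`: of the one through the corner `d` for
`b = false`, of the one through the corner `d - chirality i j` for `b = true`. -/
noncomputable def far (i : Fin m) (j : Fin n) (d : ZMod 4) (b : Bool) : Vertex m n :=
  if h : OnBorder i j d then .border i j d h b
  else .corner (stepRow i d) (stepCol j d) (if b then d - chirality (ZMod 4) i j else d + 2)

/-- The side of the square between the two creases of the pleat in direction `d`. -/
def side (i : Fin m) (j : Fin n) (d : ZMod 4) : Sym2 (Vertex m n) :=
  s(.corner i j d, .corner i j (d - chirality (ZMod 4) i j))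

/-- The two creases of the pleat in direction `d`. -/
noncomputable def pleatEdge (i : Fin m) (j : Fin n) (d : ZMod 4) (b : Bool) : Sym2 (Vertex m n) :=
  s(.corner i j (if b then d - chirality (ZMod 4) i j else d), far i j d b)

theorem onBorder_zero {i : Fin m} {j : Fin n} : OnBorder i j 0 ↔ j.val + 1 = n := by
  simp [OnBorder, show (0 : ZMod 4) ≠ 1 by decide, show (0 : ZMod 4) ≠ 2 by decide,
    show (0 : ZMod 4) ≠ 3 by decide]

theorem onBorder_one {i : Fin m} {j : Fin n} : OnBorder i j 1 ↔ i.val + 1 = m := by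
  simp [OnBorder, show (1 : ZMod 4) ≠ 0 by decide, show (1 : ZMod 4) ≠ 2 by decide,
    show (1 : ZMod 4) ≠ 3 by decide]

theorem onBorder_two {i : Fin m} {j : Fin n} : OnBorder i j 2 ↔ j.val = 0 := by
  simp [OnBorder, show (2 : ZMod 4) ≠ 0 by decide, show (2 : ZMod 4) ≠ 1 by decide,
    show (2 : ZMod 4) ≠ 3 by decide]

theorem onBorder_three {i : Fin m} {j : Fin n} : OnBorder i j 3 ↔ i.val = 0 := by
  simp [OnBorder, show (3 : ZMod 4) ≠ 0 by decide, show (3 : ZMod 4) ≠ 1 by decide,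
    show (3 : ZMod 4) ≠ 2 by decide]

/-- The neighbour in direction `d`, where it exists, in coordinates. -/
theorem step_val {i : Fin m} {j : Fin n} {d : ZMod 4} (h : ¬ OnBorder i j d) :
    d = 0 ∧ stepRow i d = i ∧ (stepCol j d).val = j.val + 1 ∨
    d = 1 ∧ (stepRow i d).val = i.val + 1 ∧ stepCol j d = j ∨
    d = 2 ∧ stepRow i d = i ∧ (stepCol j d).val + 1 = j.val ∨
    d = 3 ∧ (stepRow i d).val + 1 = i.val ∧ stepCol j d = j := by
  rcases direction_cases d with rfl | rfl | rfl | rfl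
  · rw [onBorder_zero] at h
    exact Or.inl ⟨rfl, rfl, show min _ _ = _ by omega⟩
  · rw [onBorder_one] at h
    exact Or.inr (Or.inl ⟨rfl, show min _ _ = _ by omega, rfl⟩)
  · rw [onBorder_two] at h
    exact Or.inr (Or.inr (Or.inl ⟨rfl, rfl, show j.val - 1 + 1 = j.val by omega⟩))
  · rw [onBorder_three] at h
    exact Or.inr (Or.inr (Or.inr ⟨rfl, show i.val - 1 + 1 = i.val by omega, rfl⟩))

theorem step_eq_iff {i i' : Fin m} {j j' : Fin n} {d : ZMod 4} :
    (¬ OnBorder i j d ∧ stepRow i d = i' ∧ stepCol j d = j') ↔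
    d = 0 ∧ i' = i ∧ j'.val = j.val + 1 ∨
    d = 1 ∧ i'.val = i.val + 1 ∧ j' = j ∨
    d = 2 ∧ i' = i ∧ j'.val + 1 = j.val ∨
    d = 3 ∧ i'.val + 1 = i.val ∧ j' = j := by
  constructor
  · rintro ⟨h, rfl, rfl⟩
    exact step_val h
  · intro h
    have hb : ¬ OnBorder i j d := by
      rcases h with ⟨rfl, h1, h2⟩ | ⟨rfl, h1, h2⟩ | ⟨rfl, h1, h2⟩ | ⟨rfl, h1, h2⟩
      · rw [onBorder_zero]; omega
      · rw [onBorder_one]; omega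
      · rw [onBorder_two]; omega
      · rw [onBorder_three]; omega
    refine ⟨hb, ?_⟩
    have := step_val hb
    rcases h with ⟨rfl, h1, h2⟩ | ⟨rfl, h1, h2⟩ | ⟨rfl, h1, h2⟩ | ⟨rfl, h1, h2⟩ <;>
    rcases this with ⟨hd, h3, h4⟩ | ⟨hd, h3, h4⟩ | ⟨hd, h3, h4⟩ | ⟨hd, h3, h4⟩ <;>
    first
    | exact absurd hd (by decide)
    | (simp only [Fin.ext_iff] at *; omega)

theorem step_back {i : Fin m} {j : Fin n} {d : ZMod 4} (h : ¬ OnBorder i j d) :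
    ¬ OnBorder (stepRow i d) (stepCol j d) (d + 2) ∧
      stepRow (stepRow i d) (d + 2) = i ∧ stepCol (stepCol j d) (d + 2) = j := by
  rw [step_eq_iff]
  rcases step_val h with ⟨hd, h3, h4⟩ | ⟨hd, h3, h4⟩ | ⟨hd, h3, h4⟩ | ⟨hd, h3, h4⟩
  · exact Or.inr (Or.inr (Or.inl ⟨by rw [hd]; rfl, h3.symm, h4.symm⟩))
  · exact Or.inr (Or.inr (Or.inr ⟨by rw [hd]; rfl, h3.symm, h4.symm⟩))
  · exact Or.inl ⟨by rw [hd]; rfl, h3.symm, h4.symm⟩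
  · exact Or.inr (Or.inl ⟨by rw [hd]; rfl, h3.symm, h4.symm⟩)

theorem chirality_step {i : Fin m} {j : Fin n} {d : ZMod 4} (h : ¬ OnBorder i j d) :
    chirality (ZMod 4) (stepRow i d) (stepCol j d) = -chirality (ZMod 4) i j := by
  unfold chirality
  rcases step_val h with ⟨hd, h3, h4⟩ | ⟨hd, h3, h4⟩ | ⟨hd, h3, h4⟩ | ⟨hd, h3, h4⟩
  · rw [h3, h4]; ring
  · rw [h3, h4]; ring
  · rw [h3, ← h4]; ring
  · rw [← h3, h4]; ring

theorem far_of_onBorder {i : Fin m} {j : Fin n} {d : ZMod 4} (h : OnBorder i j d) (b : Bool) :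
    far i j d b = .border i j d h b := dif_pos h

theorem far_of_not_onBorder {i : Fin m} {j : Fin n} {d : ZMod 4} (h : ¬ OnBorder i j d)
    (b : Bool) : far i j d b = .corner (stepRow i d) (stepCol j d)
      (if b then d - chirality (ZMod 4) i j else d + 2) := dif_neg h

/-- This is where the mirror symmetry enters: the chirality `c` changes sign and `2 + 2 * c = 0` in
`ZMod 4`, so a crease has the same label `b` seen from either end. -/
theorem pleatEdge_step {i : Fin m} {j : Fin n} {d : ZMod 4} (h : ¬ OnBorder i j d) (b : Bool) :
    pleatEdge (stepRow i d) (stepCol j d) (d + 2) b = pleatEdge i j d b := by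
  obtain ⟨h1, h2, h3⟩ := step_back h
  rw [pleatEdge, pleatEdge, far_of_not_onBorder h, far_of_not_onBorder h1, chirality_step h, h2, h3,
    Sym2.eq_swap]
  have e : d + 2 - -chirality (ZMod 4) i j = d - chirality (ZMod 4) i j := by
    rcases chirality_cases i j with h | h <;> rw [h] <;> clear * - <;> revert d <;> decide
  have e' : d + 2 + 2 = d := by clear * -; revert d; decide
  rw [e, e']

variable {L : ℝ}

theorem Crease.ne {v w : Vertex m n} (h : Crease m n v w) : v ≠ w := by
  intro hvw
  cases h <;> simp only [Vertex.corner.injEq, reduceCtorEq] at hvw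
  case side i j d => clear * - hvw; have := hvw.2.2; revert d; decide
  case east i j j' h => exact absurd hvw.2.2 (by decide)
  case east' i j j' h => have := hvw.2.1; subst this; omega
  case north i j j' h => exact absurd hvw.2.2 (by decide)
  case north' i j j' h => have := hvw.1; subst this; omega

theorem Crease.mem_edgeSet {v w : Vertex m n} (h : Crease m n v w) :
    s(v, w) ∈ (squareTwistTessellation m n L).graph.edgeSet :=
  (SimpleGraph.fromRel_adj ..).2 ⟨h.ne, Or.inl h⟩

theorem side_mem (i : Fin m) (j : Fin n) (d : ZMod 4) :
    side i j d ∈ (squareTwistTessellation m n L).graph.edgeSet := by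
  rw [side]
  rcases chirality_cases i j with h | h <;> rw [h]
  · have := (Crease.side i j (d - 1)).mem_edgeSet (L := L)
    rwa [sub_add_cancel, Sym2.eq_swap] at this
  · rw [sub_neg_eq_add]
    exact (Crease.side i j d).mem_edgeSet

theorem pleatEdge_mem (i : Fin m) (j : Fin n) (d : ZMod 4) (b : Bool) :
    pleatEdge i j d b ∈ (squareTwistTessellation m n L).graph.edgeSet := by
  have pos : ∀ (i : Fin m) (j : Fin n) (d : ZMod 4), ¬ OnBorder i j d → d = 0 ∨ d = 1 →
      pleatEdge i j d b ∈ (squareTwistTessellation m n L).graph.edgeSet := by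
    intro i j d h hd
    rw [pleatEdge, far_of_not_onBorder h]
    have hs := step_val h
    rcases hd with rfl | rfl
    · obtain ⟨h1, h2⟩ : stepRow i 0 = i ∧ (stepCol j 0).val = j.val + 1 := by
        simpa [show (0 : ZMod 4) ≠ 1 by decide, show (0 : ZMod 4) ≠ 2 by decide,
          show (0 : ZMod 4) ≠ 3 by decide] using hs
      rw [h1]
      cases b
      · exact (Crease.east i j _ h2.symm).mem_edgeSet
      · exact (Crease.east' i j _ h2.symm).mem_edgeSet
    · obtain ⟨h1, h2⟩ : (stepRow i 1).val = i.val + 1 ∧ stepCol j 1 = j := by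
        simpa [show (1 : ZMod 4) ≠ 0 by decide, show (1 : ZMod 4) ≠ 2 by decide,
          show (1 : ZMod 4) ≠ 3 by decide] using hs
      rw [h2]
      cases b
      · exact (Crease.north i _ j h1.symm).mem_edgeSet
      · exact (Crease.north' i _ j h1.symm).mem_edgeSet
  by_cases h : OnBorder i j d
  · rw [pleatEdge, far_of_onBorder h]
    cases b
    · exact (Crease.border i j d h).mem_edgeSet
    · exact (Crease.border' i j d h).mem_edgeSet
  · by_cases hd : d = 0 ∨ d = 1
    · exact pos i j d h hd
    · rw [← pleatEdge_step h]
      exact pos _ _ _ (step_back h).1 (by clear * - hd; revert d; decide)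

theorem exists_of_mem_edgeSet {e : Sym2 (Vertex m n)}
    (he : e ∈ (squareTwistTessellation m n L).graph.edgeSet) :
    ∃ i j d, e = side i j d ∨ ∃ b, e = pleatEdge i j d b := by
  have key : ∀ v w : Vertex m n, Crease m n v w →
      ∃ i j d, s(v, w) = side i j d ∨ ∃ b, s(v, w) = pleatEdge i j d b := by
    intro v w h
    cases h with
    | side i j d =>
      rcases chirality_cases i j with h | h
      · exact ⟨i, j, d + 1, Or.inl (by rw [side, h, add_sub_cancel_right, Sym2.eq_swap])⟩
      · exact ⟨i, j, d, Or.inl (by rw [side, h, sub_neg_eq_add])⟩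
    | east i j j' h =>
      obtain ⟨h1, h2, h3⟩ := step_eq_iff.2 (Or.inl ⟨rfl, rfl, h.symm⟩)
      exact ⟨i, j, 0, Or.inr ⟨false, by rw [pleatEdge, far_of_not_onBorder h1, h2, h3]; rfl⟩⟩
    | east' i j j' h =>
      obtain ⟨h1, h2, h3⟩ := step_eq_iff.2 (Or.inl ⟨rfl, rfl, h.symm⟩)
      exact ⟨i, j, 0, Or.inr ⟨true, by rw [pleatEdge, far_of_not_onBorder h1, h2, h3]; rfl⟩⟩
    | north i i' j h =>
      obtain ⟨h1, h2, h3⟩ := step_eq_iff.2 (Or.inr (Or.inl ⟨rfl, h.symm, rfl⟩))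
      exact ⟨i, j, 1, Or.inr ⟨false, by rw [pleatEdge, far_of_not_onBorder h1, h2, h3]; rfl⟩⟩
    | north' i i' j h =>
      obtain ⟨h1, h2, h3⟩ := step_eq_iff.2 (Or.inr (Or.inl ⟨rfl, h.symm, rfl⟩))
      exact ⟨i, j, 1, Or.inr ⟨true, by rw [pleatEdge, far_of_not_onBorder h1, h2, h3]; rfl⟩⟩
    | border i j d h =>
      exact ⟨i, j, d, Or.inr ⟨false, by rw [pleatEdge, far_of_onBorder h]; rfl⟩⟩
    | border' i j d h =>
      exact ⟨i, j, d, Or.inr ⟨true, by rw [pleatEdge, far_of_onBorder h]; rfl⟩⟩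
  induction e with
  | h v w =>
    rcases ((SimpleGraph.fromRel_adj ..).1 he).2 with h | h
    · exact key v w h
    · rw [Sym2.eq_swap]
      exact key w v h

/-- With `c` the chirality, the corner `d` lies on the sides belonging to the pleats `d` and `d +
c`, on the `false` crease of the first pleat and on the `true` crease of the second. -/
theorem adj_corner_iff (i : Fin m) (j : Fin n) (d : ZMod 4) (w : Vertex m n) :
    (squareTwistTessellation m n L).graph.Adj (.corner i j d) w ↔
      w = .corner i j (d - chirality (ZMod 4) i j) ∨ w = .corner i j (d + chirality (ZMod 4) i j) ∨
      w = far i j d false ∨ w = far i j (d + chirality (ZMod 4) i j) true := by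
  change s(Vertex.corner i j d, w) ∈ (squareTwistTessellation m n L).graph.edgeSet ↔ _
  constructor
  · intro h
    obtain ⟨i', j', d', h | ⟨b, h⟩⟩ := exists_of_mem_edgeSet h
    · rw [side, Sym2.eq_iff] at h
      rcases h with ⟨hv, rfl⟩ | ⟨hv, rfl⟩ <;>
        obtain ⟨rfl, rfl, rfl⟩ := Vertex.corner.inj hv
      · exact Or.inl rfl
      · exact Or.inr (Or.inl (by rw [sub_add_cancel]))
    · have key : ∀ (i' : Fin m) (j' : Fin n) (d' : ZMod 4),
          Vertex.corner i j d = .corner i' j' (if b then d' - chirality (ZMod 4) i' j' else d') →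
          w = far i' j' d' b →
          w = far i j d false ∨ w = far i j (d + chirality (ZMod 4) i j) true := by
        rintro i' j' d' hv rfl
        obtain ⟨rfl, rfl, rfl⟩ := Vertex.corner.inj hv
        cases b
        · exact Or.inl rfl
        · exact Or.inr (by simp)
      refine Or.inr (Or.inr ?_)
      have h' := h
      rw [pleatEdge, Sym2.eq_iff] at h
      rcases h with ⟨h1, h2⟩ | ⟨h1, h2⟩
      · exact key i' j' d' h1 h2
      -- If the corner is the far end of the crease, the same crease is described again from the
      -- neighbouring twist, where the corner is the near end.
      · have hb : ¬ OnBorder i' j' d' := fun hb => by simp [far_of_onBorder hb] at h1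
        rw [← pleatEdge_step hb, pleatEdge, Sym2.eq_iff] at h'
        rcases h' with ⟨h3, h4⟩ | ⟨h3, h4⟩
        · exact key _ _ _ h3 h4
        · rw [far_of_not_onBorder (step_back hb).1, (step_back hb).2.1, (step_back hb).2.2] at h3
          rw [far_of_not_onBorder hb, Vertex.corner.injEq] at h1
          rw [Vertex.corner.injEq] at h3
          exfalso
          -- Otherwise the corner would belong to two neighbouring twists, whose chiralities are
          -- opposite.
          have c := chirality_step hb
          rw [← h1.1, ← h1.2.1, h3.1, h3.2.1] at c
          rcases chirality_cases i' j' with h | h <;> rw [h] at c <;> exact absurd c (by decide)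
  · rintro (rfl | rfl | rfl | rfl)
    · exact side_mem i j d
    · have := side_mem (L := L) i j (d + chirality (ZMod 4) i j)
      rwa [side, add_sub_cancel_right, Sym2.eq_swap] at this
    · exact pleatEdge_mem i j d false
    · have := pleatEdge_mem (L := L) i j (d + chirality (ZMod 4) i j) true
      rwa [pleatEdge, if_pos rfl, add_sub_cancel_right] at this

/-! ### Positions -/

theorem I_pow_add_one (d : ZMod 4) : Complex.I ^ (d + 1).val = Complex.I * Complex.I ^ d.val := by
  rcases direction_cases d with rfl | rfl | rfl | rfl
  · change Complex.I ^ 1 = _ * Complex.I ^ 0; ring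
  · change Complex.I ^ 2 = _ * Complex.I ^ 1; ring
  · change Complex.I ^ 3 = _ * Complex.I ^ 2; ring
  · change Complex.I ^ 0 = _ * Complex.I ^ 3; rw [← pow_succ', Complex.I_pow_four]; rfl

theorem I_pow_sub_one (d : ZMod 4) : Complex.I ^ (d - 1).val = -(Complex.I * Complex.I ^ d.val) := by
  have := I_pow_add_one (d - 1)
  rw [sub_add_cancel] at this
  rw [this, ← mul_assoc, Complex.I_mul_I]
  ring

theorem I_pow_add_two (d : ZMod 4) : Complex.I ^ (d + 2).val = -Complex.I ^ d.val := by
  rw [show d + 2 = d + 1 + 1 by ring, I_pow_add_one, I_pow_add_one, ← mul_assoc, Complex.I_mul_I]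
  ring

theorem center_step (L : ℝ) {i : Fin m} {j : Fin n} {d : ZMod 4} (h : ¬ OnBorder i j d) :
    center L (stepRow i d) (stepCol j d) = center L i j + L * Complex.I ^ d.val := by
  unfold center
  have h2 : (2 : ZMod 4).val = 2 := rfl
  have h3 : (3 : ZMod 4).val = 3 := rfl
  have h1 : (1 : ZMod 4).val = 1 := rfl
  rcases step_val h with ⟨hd, h5, h6⟩ | ⟨hd, h5, h6⟩ | ⟨hd, h5, h6⟩ | ⟨hd, h5, h6⟩
  · rw [h5, h6, hd]
    push_cast
    simp only [ZMod.val_zero, pow_zero]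
    ring
  · rw [h5, h6, hd, h1]
    push_cast
    ring
  · rw [h5, ← h6, hd, h2, Complex.I_sq]
    push_cast
    ring
  · rw [← h5, h6, hd, h3, Complex.I_pow_three]
    push_cast
    ring

/-- The `false` crease starts at distance 1 from the centre along the pleat, the `true` crease
beside the centre, so inner creases have lengths `L - 2` and `L`. Positivity of the first is the
condition `2 < L`. -/
theorem exists_position_far (hL : 2 < L) (i : Fin m) (j : Fin n) (d : ZMod 4) (b : Bool) :
    ∃ t : ℝ, 0 < t ∧ position L (far i j d b) -
      position L (.corner i j (if b then d - chirality (ZMod 4) i j else d)) =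
        t * Complex.I ^ d.val := by
  by_cases h : OnBorder i j d
  · rw [far_of_onBorder h]
    cases b
    · refine ⟨L / 2 - 1, by linarith, ?_⟩
      simp [position]
      ring
    · refine ⟨L / 2, by linarith, ?_⟩
      simp [position]
  · rw [far_of_not_onBorder h]
    cases b
    · refine ⟨L - 2, by linarith, ?_⟩
      simp [position, center_step L h, I_pow_add_two]
      ring
    · refine ⟨L, by linarith, ?_⟩
      simp [position, center_step L h]

theorem corner_isInterior (hL : 2 < L) (i : Fin m) (j : Fin n) (d : ZMod 4) :
    (squareTwistTessellation m n L).IsInterior (.corner i j d) := by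
  have hb : |(Complex.I ^ d.val).re| ≤ 1 ∧ |(Complex.I ^ d.val).im| ≤ 1 := by
    constructor
    · exact (Complex.abs_re_le_norm _).trans (by simp)
    · exact (Complex.abs_im_le_norm _).trans (by simp)
  obtain ⟨⟨h1, h2⟩, h3, h4⟩ := And.imp abs_le.1 abs_le.1 hb
  have hi : (i.val : ℝ) + 1 ≤ m := by exact_mod_cast i.2
  have hj : (j.val : ℝ) + 1 ≤ n := by exact_mod_cast j.2
  have hi0 : (0 : ℝ) ≤ i.val := by positivity
  have hj0 : (0 : ℝ) ≤ j.val := by positivity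
  change position L (.corner i j d) ∈ interior (_ ×ℂ _)
  rw [Complex.interior_reProdIm, interior_Icc, interior_Icc, Complex.mem_reProdIm]
  have hre : (position L (.corner i j d)).re = L * j + (Complex.I ^ d.val).re := by
    simp [position, center]
  have him : (position L (.corner i j d)).im = L * i + (Complex.I ^ d.val).im := by
    simp [position, center]
  rw [hre, him]
  refine ⟨⟨?_, ?_⟩, ?_, ?_⟩ <;> nlinarith

theorem border_not_isInterior (i : Fin m) (j : Fin n) (d : ZMod 4) (h : OnBorder i j d) (b : Bool) :
    ¬ (squareTwistTessellation m n L).IsInterior (.border i j d h b) := by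
  change position L (.border i j d h b) ∉ interior (_ ×ℂ _)
  rw [Complex.interior_reProdIm, interior_Icc, interior_Icc, Complex.mem_reProdIm]
  rintro ⟨⟨h1, h2⟩, h3, h4⟩
  have v2 : (2 : ZMod 4).val = 2 := rfl
  have v3 : (3 : ZMod 4).val = 3 := rfl
  have v1 : (1 : ZMod 4).val = 1 := rfl
  have v0 : (0 : ZMod 4).val = 0 := rfl
  have c1 : Complex.I ^ (d - chirality (ZMod 4) i j).val = Complex.I * Complex.I ^ d.val ∨
      Complex.I ^ (d - chirality (ZMod 4) i j).val = -(Complex.I * Complex.I ^ d.val) := by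
    rcases chirality_cases i j with h | h <;> rw [h]
    · exact Or.inr (I_pow_sub_one d)
    · rw [sub_neg_eq_add]
      exact Or.inl (I_pow_add_one d)
  -- The displacement `x` is parallel to the border, so it does not affect the coordinate that
  -- reaches the edge of the paper.
  obtain ⟨x, hx⟩ : ∃ x : ℝ, position L (.border i j d h b) = center L i j +
      ((L / 2 : ℝ) : ℂ) * Complex.I ^ d.val + x * (Complex.I * Complex.I ^ d.val) := by
    cases b
    · exact ⟨0, by simp [position]⟩
    · rcases c1 with c1 | c1
      · exact ⟨1, by rw [position, c1]; simp⟩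
      · exact ⟨-1, by rw [position, c1]; simp⟩
  rw [hx] at h1 h2 h3 h4
  rcases direction_cases d with rfl | rfl | rfl | rfl
  · have hn := congrArg (Nat.cast : ℕ → ℝ) (onBorder_zero.1 h)
    push_cast at hn
    simp [center, v0] at h2
    rw [← hn] at h2
    linarith
  · have hm := congrArg (Nat.cast : ℕ → ℝ) (onBorder_one.1 h)
    push_cast at hm
    simp [center, v1] at h4
    rw [← hm] at h4
    linarith
  · have hn := congrArg (Nat.cast : ℕ → ℝ) (onBorder_two.1 h)
    simp [center, v2] at h1
    rw [hn] at h1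
    simp at h1
  · have hm := congrArg (Nat.cast : ℕ → ℝ) (onBorder_three.1 h)
    simp [center, v3, Complex.I_pow_three] at h3
    rw [hm] at h3
    simp at h3

end SquareTwist

/-! ### The sign conditions at the corners -/

namespace SquareTwist

variable {m n : ℕ} {L : ℝ}

/-- At a corner, the two creases bounding the 45° sector differ, and the two creases bounding the
135° sector agree. -/
theorem foldsFlatAt_corner_iff (hL : 2 < L) (μ : (squareTwistTessellation m n L).MVAssignment)
    (i : Fin m) (j : Fin n) (d : ZMod 4) :
    (squareTwistTessellation m n L).FoldsFlatAt μ (.corner i j d) ↔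
      μ ⟨pleatEdge i j (d + chirality (ZMod 4) i j) true, pleatEdge_mem ..⟩ =
        -μ ⟨side i j (d + chirality (ZMod 4) i j), side_mem ..⟩ ∧
      μ ⟨pleatEdge i j d false, pleatEdge_mem ..⟩ = μ ⟨side i j d, side_mem ..⟩ := by
  have h2 : ((√2 : ℝ) : ℂ) * (√2 : ℝ) = 2 := by
    rw [← Complex.ofReal_mul, Real.mul_self_sqrt (by norm_num)]; simp
  have h0 : ((√2 : ℝ) : ℂ) ≠ 0 := by
    intro h; simp [h] at h2
  have hI : Complex.I * Complex.I = -1 := Complex.I_mul_I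
  have hd0 : Complex.I ^ d.val ≠ 0 := pow_ne_zero _ Complex.I_ne_zero
  have hs : (0 : ℝ) < √2 := by positivity
  obtain ⟨t, ht, hft⟩ := exists_position_far hL i j (d + chirality (ZMod 4) i j) true
  obtain ⟨t', ht', hff⟩ := exists_position_far hL i j d false
  have hadj := adj_corner_iff (L := L) i j d
  have hm1 : μ ⟨s(.corner i j d, .corner i j (d + chirality (ZMod 4) i j)),
      (hadj _).2 (Or.inr (Or.inl rfl))⟩ =
      μ ⟨side i j (d + chirality (ZMod 4) i j), side_mem ..⟩ :=
    congrArg μ (Subtype.ext (by simp only [side, add_sub_cancel_right]; exact Sym2.eq_swap))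
  have hm2 : μ ⟨s(.corner i j d, far i j (d + chirality (ZMod 4) i j) true),
      (hadj _).2 (Or.inr (Or.inr (Or.inr rfl)))⟩ =
      μ ⟨pleatEdge i j (d + chirality (ZMod 4) i j) true, pleatEdge_mem ..⟩ :=
    congrArg μ (Subtype.ext (by simp only [pleatEdge, if_true, add_sub_cancel_right]; rfl))
  have hr : ∀ w a b c e : Vertex m n, (∃ k, ![a, b, c, e] k = w) ↔
      w = a ∨ w = b ∨ w = c ∨ w = e := fun w a b c e => by
    simp [Fin.exists_fin_succ, eq_comm]
  simp only [if_true, add_sub_cancel_right] at hft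
  simp only [Bool.false_eq_true, if_false] at hff
  have hp : ∀ d', position L (.corner i j d') - position L (.corner i j d) =
      Complex.I ^ d'.val - Complex.I ^ d.val := fun d' => by simp [position]
  -- The counterclockwise order of the creases depends on the chirality. The 45° sector begins with
  -- the pleat crease when the chirality is 1 and with the square side when it is -1.
  rcases chirality_cases i j with hc | hc
  · refine ((squareTwistTessellation m n L).foldsFlatAt_iff_of_range μ (.corner i j d)
      ![far i j (d + chirality (ZMod 4) i j) true, .corner i j (d + chirality (ZMod 4) i j),
        .corner i j (d - chirality (ZMod 4) i j), far i j d false]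
      (fun w => (hadj w).trans (((hr _ _ _ _ _).trans (by tauto)).symm))
      (u := Complex.I * Complex.I ^ d.val) (mul_ne_zero Complex.I_ne_zero hd0)
      ![t, √2, √2, t'] (fun k => by fin_cases k <;> assumption) fun k => ?_).trans ?_
    · rw [exp_twistDir]
      rw [hc, I_pow_add_one] at hft
      have hp1 := hp (d + 1)
      have hp2 := hp (d - 1)
      rw [I_pow_add_one] at hp1
      rw [I_pow_sub_one] at hp2
      rw [hc]
      fin_cases k
      · refine hft.trans ?_
        simp
      · refine hp1.trans ?_
        simp
        field_simp
        linear_combination -hI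
      · refine hp2.trans ?_
        simp
        field_simp
        linear_combination -hI
      · refine hff.trans ?_
        simp
        linear_combination (t' * Complex.I ^ d.val) * hI
    · rw [← hm1, ← hm2]
      exact and_congr (by rw [eq_comm, neg_eq_iff_eq_neg]; rfl) Iff.rfl
  · refine ((squareTwistTessellation m n L).foldsFlatAt_iff_of_range μ (.corner i j d)
      ![.corner i j (d + chirality (ZMod 4) i j), far i j (d + chirality (ZMod 4) i j) true,
        far i j d false, .corner i j (d - chirality (ZMod 4) i j)]
      (fun w => (hadj w).trans (((hr _ _ _ _ _).trans (by tauto)).symm))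
      (u := Complex.I ^ d.val * ((-1 - Complex.I) / (√2 : ℝ)))
      (mul_ne_zero hd0 (div_ne_zero (fun h => by
        have := congrArg Complex.re h; simp at this) h0))
      ![√2, t, t', √2] (fun k => by fin_cases k <;> assumption) fun k => ?_).trans ?_
    · rw [exp_twistDir]
      rw [hc, ← sub_eq_add_neg, I_pow_sub_one] at hft
      have hp1 := hp (d + 1)
      have hp2 := hp (d - 1)
      rw [I_pow_add_one] at hp1
      rw [I_pow_sub_one] at hp2
      rw [hc, ← sub_eq_add_neg, sub_neg_eq_add]
      fin_cases k
      · refine hp2.trans ?_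
        simp
        field_simp
        ring
      · refine hft.trans ?_
        simp
        field_simp
        linear_combination (t : ℂ) * (hI - Complex.I * h2)
      · refine hff.trans ?_
        simp
        field_simp
        left
        linear_combination hI + h2
      · refine hp1.trans ?_
        simp
        field_simp
        linear_combination -hI
    · rw [← hm1, ← hm2]
      exact and_congr Iff.rfl eq_comm

/-- The 45° condition for the pleat `d` comes from the corner `d - chirality i j`, the 135°
condition from the corner `d`. Regrouped by pleat, the conditions at different corners involve the
sides one at a time. -/
theorem locallyFoldsFlat_iff (hL : 2 < L) (μ : (squareTwistTessellation m n L).MVAssignment) :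
    (squareTwistTessellation m n L).LocallyFoldsFlat μ ↔ ∀ i j d,
      μ ⟨pleatEdge i j d false, pleatEdge_mem ..⟩ = μ ⟨side i j d, side_mem ..⟩ ∧
      μ ⟨pleatEdge i j d true, pleatEdge_mem ..⟩ = -μ ⟨side i j d, side_mem ..⟩ := by
  constructor
  · intro h i j d
    refine ⟨((foldsFlatAt_corner_iff hL μ i j d).1 (h _ (corner_isInterior hL i j d))).2, ?_⟩
    have := ((foldsFlatAt_corner_iff hL μ i j (d - chirality (ZMod 4) i j)).1
      (h _ (corner_isInterior hL i j _))).1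
    simpa only [sub_add_cancel] using this
  · rintro h (⟨i, j, d⟩ | ⟨i, j, d, hb, b⟩) hv
    · exact (foldsFlatAt_corner_iff hL μ i j d).2 ⟨(h i j _).2, (h i j d).1⟩
    · exact absurd hv (border_not_isInterior i j d hb b)

end SquareTwist

namespace SquareTwist

variable {m n : ℕ} {L : ℝ}

/-! ### Counting -/

/-- The pleats between horizontally and between vertically adjacent cells, including those that run
into the border. -/
abbrev Pleat (m n : ℕ) : Type := (Fin m × Fin (n + 1)) ⊕ (Fin (m + 1) × Fin n)

/-- The pleat that leaves the twist `(i, j)` in direction `d`. -/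
def pleat (i : Fin m) (j : Fin n) (d : ZMod 4) : Pleat m n :=
  if d = 0 then .inl (i, j.succ) else if d = 1 then .inr (i.succ, j)
  else if d = 2 then .inl (i, j.castSucc) else .inr (i.castSucc, j)

theorem pleat_step {i : Fin m} {j : Fin n} {d : ZMod 4} (h : ¬ OnBorder i j d) :
    pleat (stepRow i d) (stepCol j d) (d + 2) = pleat i j d := by
  rcases step_val h with ⟨hd, h3, h4⟩ | ⟨hd, h3, h4⟩ | ⟨hd, h3, h4⟩ | ⟨hd, h3, h4⟩ <;>
    generalize stepRow i d = i' at * <;> generalize stepCol j d = j' at * <;> subst hd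
  · rw [h3]
    change Sum.inl (i, j'.castSucc) = Sum.inl (i, j.succ)
    congr 2; ext; simpa using h4
  · rw [h4]
    change Sum.inr (i'.castSucc, j) = Sum.inr (i.succ, j)
    congr 2; ext; simpa using h3
  · rw [h3]
    change Sum.inl (i, j'.succ) = Sum.inl (i, j.castSucc)
    congr 2; ext; simpa using h4
  · rw [h4]
    change Sum.inr (i'.succ, j) = Sum.inr (i.castSucc, j)
    congr 2; ext; simpa using h3

theorem pleat_surjective (hm : 1 ≤ m) (hn : 1 ≤ n) (p : Pleat m n) : ∃ i j d, pleat i j d = p := by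
  rcases p with ⟨i, j⟩ | ⟨i, j⟩
  · rcases Fin.eq_zero_or_eq_succ j with rfl | ⟨j, rfl⟩
    · exact ⟨i, ⟨0, hn⟩, 2, rfl⟩
    · exact ⟨i, j, 0, rfl⟩
  · rcases Fin.eq_zero_or_eq_succ i with rfl | ⟨i, rfl⟩
    · exact ⟨⟨0, hm⟩, j, 3, rfl⟩
    · exact ⟨i, j, 1, rfl⟩

/-- A pleat can be named only from its two ends. -/
theorem pleat_eq {i i' : Fin m} {j j' : Fin n} {d d' : ZMod 4} (h : pleat i j d = pleat i' j' d') :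
    (i' = i ∧ j' = j ∧ d' = d) ∨
      (¬ OnBorder i j d ∧ stepRow i d = i' ∧ stepCol j d = j') ∧ d' = d + 2 := by
  rw [step_eq_iff]
  rcases direction_cases d with rfl | rfl | rfl | rfl <;>
  rcases direction_cases d' with rfl | rfl | rfl | rfl <;>
  simp [pleat, show (1 : ZMod 4) ≠ 0 by decide, show (2 : ZMod 4) ≠ 0 by decide,
    show (3 : ZMod 4) ≠ 0 by decide, show (2 : ZMod 4) ≠ 1 by decide,
    show (3 : ZMod 4) ≠ 1 by decide, show (3 : ZMod 4) ≠ 2 by decide, show (2 : ZMod 4) + 2 = 0 by decide,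
    show (1 : ZMod 4) + 2 = 3 by decide, show (3 : ZMod 4) + 2 = 1 by decide, Fin.ext_iff] at h ⊢ <;>
  omega

theorem pleatEdge_congr {i i' : Fin m} {j j' : Fin n} {d d' : ZMod 4}
    (h : pleat i j d = pleat i' j' d') (b : Bool) : pleatEdge i j d b = pleatEdge i' j' d' b := by
  rcases pleat_eq h with ⟨rfl, rfl, rfl⟩ | ⟨⟨hb, rfl, rfl⟩, rfl⟩
  · rfl
  · exact (pleatEdge_step hb b).symm

/-- The pleat of a crease with given ends, and its sign relative to the sides of the squares
between the two creases of the pleat. -/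
def pleatSign : Vertex m n → Vertex m n → Pleat m n × ℤˣ
  | .corner i j d, .corner i' j' d' =>
    -- A side belongs to the pleat at the end that exceeds the other by the chirality.
    if i = i' ∧ j = j' then (pleat i j (if d = d' + chirality (ZMod 4) i j then d else d'), 1)
    else (pleat i j (if i < i' then 1 else if i' < i then 3 else if j < j' then 0 else 2),
      -- Between neighbouring twists, the `true` crease joins corners of equal index, the `false`
      -- crease corners of opposite index.
      if d = d' then -1 else 1)
  | .corner _ _ _, .border i j d _ b => (pleat i j d, if b then -1 else 1)
  | .border i j d _ b, _ => (pleat i j d, if b then -1 else 1)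

/-- The assignment in which the sides of the squares at the pleat `p` have the value `s p`. -/
noncomputable def assignment (L : ℝ) (s : Pleat m n → ℤˣ) :
    (squareTwistTessellation m n L).MVAssignment :=
  fun e => (pleatSign (Quot.out e.1).1 (Quot.out e.1).2).2 *
    s (pleatSign (Quot.out e.1).1 (Quot.out e.1).2).1

/-- `Quot.out` may return the ends of a crease in either order, so `pleatSign` has to be evaluated
for both. -/
theorem assignment_apply (s : Pleat m n → ℤˣ) {v w : Vertex m n}
    (h : s(v, w) ∈ (squareTwistTessellation m n L).graph.edgeSet) {p : Pleat m n × ℤˣ}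
    (h1 : pleatSign v w = p) (h2 : pleatSign w v = p) :
    assignment L s ⟨s(v, w), h⟩ = p.2 * s p.1 := by
  have key : pleatSign (Quot.out s(v, w)).1 (Quot.out s(v, w)).2 = p := by
    have : s((Quot.out s(v, w)).1, (Quot.out s(v, w)).2) = s(v, w) := Quot.out_eq s(v, w)
    rcases Sym2.eq_iff.1 this with ⟨ha, hb⟩ | ⟨ha, hb⟩ <;> rw [ha, hb] <;> assumption
  rw [assignment]
  exact congrArg (fun p : Pleat m n × ℤˣ => p.2 * s p.1) key

theorem assignment_side (s : Pleat m n → ℤˣ) (i : Fin m) (j : Fin n) (d : ZMod 4) :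
    assignment L s ⟨side i j d, side_mem ..⟩ = s (pleat i j d) := by
  have hne : d - chirality (ZMod 4) i j ≠ d + chirality (ZMod 4) i j := by
    rcases chirality_cases i j with h | h <;> rw [h] <;> clear * - <;> revert d <;> decide
  have := assignment_apply (L := L) s (v := .corner i j d)
    (w := .corner i j (d - chirality (ZMod 4) i j)) (side_mem i j d) (p := (pleat i j d, 1))
    (by simp [pleatSign]) (by simp [pleatSign, hne])
  rw [one_mul] at this
  exact this

theorem pleatSign_far {i : Fin m} {j : Fin n} {d : ZMod 4} (h : ¬ OnBorder i j d) (b : Bool) :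
    pleatSign (.corner i j (if b then d - chirality (ZMod 4) i j else d)) (far i j d b) =
      (pleat i j d, if b then -1 else 1) := by
  rw [far_of_not_onBorder h]
  have hd : (if b = true then d - chirality (ZMod 4) i j else d) =
      (if b = true then d - chirality (ZMod 4) i j else d + 2) ↔ b = true := by
    cases b
    · simp; decide
    · simp
  simp only [pleatSign, hd]
  rcases step_val h with ⟨hd, h3, h4⟩ | ⟨hd, h3, h4⟩ | ⟨hd, h3, h4⟩ | ⟨hd, h3, h4⟩
  · rw [if_neg (fun h => by rw [← h.2] at h4; omega), h3, if_neg (lt_irrefl _),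
      if_neg (lt_irrefl _), if_pos (Fin.lt_def.2 (by omega)), hd]
  · rw [if_neg (fun h => by rw [← h.1] at h3; omega), if_pos (Fin.lt_def.2 (by omega)), hd]
  · rw [if_neg (fun h => by rw [← h.2] at h4; omega), h3, if_neg (lt_irrefl _),
      if_neg (lt_irrefl _), if_neg (fun h => by have := Fin.lt_def.1 h; omega), hd]
  · rw [if_neg (fun h => by rw [← h.1] at h3; omega),
      if_neg (fun h => by have := Fin.lt_def.1 h; omega), if_pos (Fin.lt_def.2 (by omega)), hd]

theorem assignment_pleatEdge (s : Pleat m n → ℤˣ) (i : Fin m) (j : Fin n) (d : ZMod 4) (b : Bool) :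
    assignment L s ⟨pleatEdge i j d b, pleatEdge_mem ..⟩ =
      (if b then -1 else 1) * s (pleat i j d) := by
  refine assignment_apply s (pleatEdge_mem i j d b) (p := (pleat i j d, if b then -1 else 1)) ?_ ?_
  · by_cases h : OnBorder i j d
    · rw [far_of_onBorder h]; rfl
    · exact pleatSign_far h b
  · by_cases h : OnBorder i j d
    · rw [far_of_onBorder h]; rfl
    · obtain ⟨h1, h2, h3⟩ := step_back h
      have := pleatSign_far h1 b
      rw [pleat_step h, far_of_not_onBorder h1, chirality_step h, h2, h3] at this
      rw [far_of_not_onBorder h, ← this]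
      have e : d + 2 - -chirality (ZMod 4) i j = d - chirality (ZMod 4) i j := by
        rcases chirality_cases i j with h | h <;> rw [h] <;> clear * - <;> revert d <;> decide
      have e' : d + 2 + 2 = d := by clear * -; revert d; decide
      rw [e, e']

theorem locallyFoldsFlat_iff_exists (hL : 2 < L) (hm : 1 ≤ m) (hn : 1 ≤ n)
    (μ : (squareTwistTessellation m n L).MVAssignment) :
    (squareTwistTessellation m n L).LocallyFoldsFlat μ ↔
      μ ∈ Set.range (assignment (m := m) (n := n) L) := by
  rw [locallyFoldsFlat_iff hL]
  constructor
  · intro h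
    choose I J D hp using pleat_surjective hm hn
    -- The sides at the two ends of a pleat agree, because both equal its `false` crease.
    have hs : ∀ i j d, μ ⟨side (I (pleat i j d)) (J (pleat i j d)) (D (pleat i j d)), side_mem ..⟩ =
        μ ⟨side i j d, side_mem ..⟩ := by
      intro i j d
      rw [← (h _ _ _).1, ← (h _ _ _).1]
      exact congrArg μ (Subtype.ext (pleatEdge_congr (hp _) false))
    refine ⟨fun p => μ ⟨side (I p) (J p) (D p), side_mem ..⟩, funext fun e => ?_⟩
    obtain ⟨e, he⟩ := e
    obtain ⟨i, j, d, rfl | ⟨b, rfl⟩⟩ := exists_of_mem_edgeSet he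
    · rw [assignment_side, hs]
    · rw [assignment_pleatEdge, hs]
      cases b
      · simp [(h i j d).1]
      · simp [(h i j d).2]
  · rintro ⟨s, rfl⟩ i j d
    simp [assignment_pleatEdge, assignment_side]

theorem assignment_injective (hm : 1 ≤ m) (hn : 1 ≤ n) :
    Function.Injective (assignment (m := m) (n := n) L) := by
  intro s s' h
  funext p
  obtain ⟨i, j, d, rfl⟩ := pleat_surjective hm hn p
  rw [← assignment_side (L := L) s, h, assignment_side]

end SquareTwist

theorem mainTheorem1 (m n : ℕ) (hm : 1 ≤ m) (hn : 1 ≤ n) (L : ℝ) (hL : 2 < L) :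
    Nat.card {μ : (squareTwistTessellation m n L).MVAssignment //
        (squareTwistTessellation m n L).LocallyFoldsFlat μ} = 2 ^ (2 * m * n + m + n) := by
  simp only [SquareTwist.locallyFoldsFlat_iff_exists hL hm hn]
  rw [← Nat.card_congr (Equiv.ofInjective _ (SquareTwist.assignment_injective (L := L) hm hn)),
    Nat.card_eq_fintype_card, Fintype.card_fun]
  simp only [Fintype.card_sum, Fintype.card_prod, Fintype.card_fin, Fintype.card_units_int]
  -- The exponent is the number of pleats, `m * (n + 1) + (m + 1) * n`.
  congr 1
  ring
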